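/- Let $(W,S)$ be a Coxeter system ($S$ and $W$ may be infinite), with length function $\ell$. Let $\bar S$ be the set of classes of elements of $S$ under conjugacy in $W$, and $\bar s\in\bar S$ the class of $s\in S$. Let $\Gamma$ be an abelian group with a total order compatible with addition, and let $\mathbb Z[\Gamma]=\bigoplus_{\gamma\in\Gamma}\mathbb Z e^\gamma$ be its group ring, with the involution $\overline{e^\gamma}=e^{-\gamma}$. For a map $\varphi:\bar S\to\Gamma$, write $\varphi(s)=\varphi(\bar s)$ and let $\mathcal H(W,S,\varphi)$ be the Hecke algebra: the free $\mathbb Z[\Gamma]$-module with basis $(T_w^\varphi)_{w\in W}$ and the unique associative $\mathbb Z[\Gamma]$-bilinear multiplication such that $T_wT_{w'}=T_{ww'}$ if $\ell(ww')=\ell(w)+\ell(w')$ and $(T_s-e^{\varphi(s)})(T_s+e^{-\varphi(s)})=0$ for $s\in S$. The bar involution is the additive map $\overline{\sum_w a_wT_w}=\sum_w\overline{a_w}\,T_{w^{-1}}^{-1}$. Let $\mathcal H_{<0}(W,S,\varphi)=\bigoplus_{w}\mathbb Z[\Gamma_{<0}]\,T_w$, where $\mathbb Z[\Gamma_{<0}]=\bigoplus_{\gamma<0}\mathbb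 Z e^\gamma$, and let $C_w^\varphi$ be the unique element with $\overline{C_w^\varphi}=C_w^\varphi$ and $C_w^\varphi\equiv T_w^\varphi \bmod \mathcal H_{<0}(W,S,\varphi)$; the $C_w^\varphi$ form a $\mathbb Z[\Gamma]$-basis. For $x,y\in W$ write $x\leftarrow_L y$ (respectively $x\leftarrow_R y$, $x\leftarrow_{LR}y$) if there is $h\in\mathcal H(W,S,\varphi)$ such that $C_x^\varphi$ occurs with non-zero coefficient in $hC_y^\varphi$ (respectively in $C_y^\varphi h$, in $hC_y^\varphi$ or $C_y^\varphi h$). For $?\in\{L,R,LR\}$ let $\leq_?^\varphi$ be the transitive closure of $\leftarrow_?$ (a preorder), and let $\sim_?^\varphi$ be the associated equivalence relation, whose classes are the left, right and two-sided cells. Let $S=S_+\,\dot\cup\,S_-$ be a partition (either part may be empty) such that no element of $S_+$ is conjugate in $W$ to an element of $S_-$. Let $\varphi':\bar S\to\Gamma$ be given by $\varphi'(\bar s)=\varphi(\bar s)$ if $s\in S_+$ and $\varphi'(\bar s)=-\varphi(\bar s)$ if $s\in S_-$. Let $\ell_-(w)$ be the number of occurrences of elements of $S_-$ in a reduced expression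 of $w$ (it does not depend on the expression), and let $\theta:\mathcal H(W,S,\varphi)\to\mathcal H(W,S,\varphi')$ be the $\mathbb Z[\Gamma]$-linear map with $\theta(T_w^\varphi)=(-1)^{\ell_-(w)}T_w^{\varphi'}$ for all $w\in W$. Then: 1. $\theta$ is an isomorphism of $\mathbb Z[\Gamma]$-algebras. 2. $\theta$ maps $\mathcal H_{<0}(W,S,\varphi)$ onto $\mathcal H_{<0}(W,S,\varphi')$. 3. $\theta(\overline h)=\overline{\theta(h)}$ for all $h\in\mathcal H(W,S,\varphi)$. 4. $\theta(C_w^\varphi)=(-1)^{\ell_-(w)}C_w^{\varphi'}$ for all $w\in W$. 5. For each $?\in\{L,R,LR\}$, the relations $\leq_?^\varphi$ and $\leq_?^{\varphi'}$ on $W$ coincide, and so do $\sim_?^\varphi$ and $\sim_?^{\varphi'}$. -/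

import Mathlib

namespace KazhdanLusztig

section Coxeter

variable {B W : Type*} [Group W] {M : CoxeterMatrix B} (cs : CoxeterSystem M W)

/-! ### The exchange condition -/

open Classical in
/-- The map `(t, e) ↦ (s t s, e + [t = s])` on pairs of a group element and a sign. -/
noncomputable def signedConj (i : B) : Function.End (W × ZMod 2) :=
  fun p => (cs.simple i * p.1 * cs.simple i, p.2 + if p.1 = cs.simple i then 1 else 0)

open Classical in
theorem signedConj_apply (i : B) (t : W) (e : ZMod 2) :
    signedConj cs i (t, e) =
      (cs.simple i * t * cs.simple i, e + if t = cs.simple i then 1 else 0) := rfl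

open Classical in
theorem signedConj_pow (i j : B) (k : ℕ) (t : W) (e : ZMod 2) :
    ((signedConj cs i * signedConj cs j) ^ k) (t, e) =
      ((cs.simple i * cs.simple j) ^ k * t * ((cs.simple i * cs.simple j) ^ k)⁻¹,
        e + ∑ l ∈ Finset.range (2 * k),
          if t = cs.simple j * (cs.simple i * cs.simple j) ^ l then 1 else 0) := by
  have hsj : cs.simple j * cs.simple j = 1 := cs.simple_mul_simple_self j
  have hsi : cs.simple i * cs.simple i = 1 := cs.simple_mul_simple_self i
  obtain ⟨p, hpd⟩ : ∃ p, p = cs.simple i * cs.simple j := ⟨_, rfl⟩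
  have hsp : p * cs.simple j * p = cs.simple j := by
    rw [hpd]; simp [mul_assoc]
  have hp : ∀ l : ℕ, p ^ l * cs.simple j * p ^ l = cs.simple j := by
    intro l
    induction l with
    | zero => simp
    | succ l ih =>
      calc p ^ (l + 1) * cs.simple j * p ^ (l + 1)
          = p ^ l * (p * cs.simple j * p) * p ^ l := by
            rw [pow_succ]; nth_rw 2 [← pow_succ]; rw [pow_succ']; simp only [mul_assoc]
        _ = _ := by rw [hsp, ih]
  have hp' : ∀ l : ℕ, (p ^ l)⁻¹ * cs.simple j = cs.simple j * p ^ l := by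
    intro l
    rw [inv_mul_eq_iff_eq_mul, ← mul_assoc, hp]
  rw [← hpd]
  induction k with
  | zero => simp [Function.End.one_def]
  | succ k ih =>
    have key : (signedConj cs i * signedConj cs j) ^ (k + 1) =
        signedConj cs i * (signedConj cs j * (signedConj cs i * signedConj cs j) ^ k) := by
      rw [pow_succ', mul_assoc]
    rw [key]
    change signedConj cs i (signedConj cs j
      (((signedConj cs i * signedConj cs j) ^ k) (t, e))) = _
    rw [ih, signedConj_apply, signedConj_apply, show 2 * (k + 1) = 2 * k + 1 + 1 by ring, Finset.sum_range_succ,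
      Finset.sum_range_succ]
    have h1 : (p ^ k * t * (p ^ k)⁻¹ = cs.simple j) ↔ (t = cs.simple j * p ^ (2 * k)) := by
      rw [mul_inv_eq_iff_eq_mul, ← eq_inv_mul_iff_mul_eq, ← mul_assoc, hp', mul_assoc, ← pow_add,
        two_mul]
    have h2 : (cs.simple j * (p ^ k * t * (p ^ k)⁻¹) * cs.simple j = cs.simple i) ↔
        (t = cs.simple j * p ^ (2 * k + 1)) := by
      have : cs.simple i = cs.simple j * (cs.simple j * p) * cs.simple j := by
        rw [hpd]; simp [mul_assoc]
      rw [this, mul_left_inj, mul_right_inj, mul_inv_eq_iff_eq_mul, ← eq_inv_mul_iff_mul_eq,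
        ← mul_assoc, ← mul_assoc, hp', mul_assoc, mul_assoc, ← pow_succ', ← pow_add]
      ring_nf
    ext1
    · rw [pow_succ', hpd]
      simp only [mul_inv_rev, CoxeterSystem.inv_simple, mul_assoc]
    · rw [if_congr h1 rfl rfl, if_congr h2 rfl rfl]
      ring

theorem isLiftable_signedConj : M.IsLiftable (signedConj cs) := by
  classical
  intro i j
  funext ⟨t, e⟩
  rw [signedConj_pow, cs.simple_mul_simple_pow, two_mul, Finset.sum_range_add]
  have : ∀ l, (cs.simple i * cs.simple j) ^ (M i j + l) = (cs.simple i * cs.simple j) ^ l := by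
    intro l; rw [pow_add, cs.simple_mul_simple_pow, one_mul]
  simp only [this, CharTwo.add_self_eq_zero]
  simp [Function.End.one_def]

open Classical in
theorem lift_signedConj (ω : List B) (t : W) (e : ZMod 2) :
    cs.lift ⟨signedConj cs, isLiftable_signedConj cs⟩ (cs.wordProd ω) (t, e) =
      (cs.wordProd ω * t * (cs.wordProd ω)⁻¹, e + ((cs.rightInvSeq ω).count t : ZMod 2)) := by
  induction ω with
  | nil => simp [Function.End.one_def]
  | cons i ω ih =>
    rw [cs.wordProd_cons, map_mul]
    change cs.lift ⟨signedConj cs, isLiftable_signedConj cs⟩ (cs.simple i)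
      (cs.lift ⟨signedConj cs, isLiftable_signedConj cs⟩ (cs.wordProd ω) (t, e)) = _
    rw [ih, cs.lift_apply_simple]
    have h : (cs.wordProd ω * t * (cs.wordProd ω)⁻¹ = cs.simple i) ↔
        ((cs.wordProd ω)⁻¹ * cs.simple i * cs.wordProd ω = t) := by
      constructor
      · rintro h; rw [← h]; group
      · rintro rfl; group
    ext1
    · simp [signedConj, mul_assoc]
    · simp only [signedConj, CoxeterSystem.rightInvSeq, List.count_cons, beq_iff_eq]
      rw [if_congr h rfl rfl]
      push_cast
      ring

/-- Exchange condition on the right: a right descent of a reduced word is realised by deleting a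
letter. -/
theorem exists_eraseIdx_of_rightDescent {ω : List B} {i : B}
    (h : cs.length (cs.wordProd ω * cs.simple i) < cs.length (cs.wordProd ω)) :
    ∃ j, ∃ hj : j < ω.length,
      cs.wordProd ω * cs.simple i = cs.wordProd (ω.eraseIdx j) ∧
      IsConj (cs.simple i) (cs.simple ω[j]) := by
  classical
  obtain ⟨ω', hω', hw'⟩ := cs.exists_isReduced (cs.wordProd ω * cs.simple i)
  have hw : cs.wordProd ω = cs.wordProd (ω'.concat i) := by
    rw [cs.wordProd_concat, ← hw']; simp
  have hnot : cs.simple i ∉ cs.rightInvSeq ω' := by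
    intro hmem
    have := (cs.isRightInversion_of_mem_rightInvSeq hω' hmem).2
    rw [← hw'] at this
    simp only [CoxeterSystem.simple_mul_simple_cancel_right] at this
    omega
  have hnot' : cs.simple i ∉ List.map (MulAut.conj (cs.simple i)) (cs.rightInvSeq ω') := by
    intro hmem
    obtain ⟨x, hx, hxe⟩ := List.mem_map.1 hmem
    apply hnot
    have : x = cs.simple i := by
      rw [MulAut.conj_apply, mul_inv_eq_iff_eq_mul, mul_right_inj] at hxe
      exact hxe
    rwa [← this]
  have h1 := lift_signedConj cs ω (cs.simple i) 0
  rw [hw, lift_signedConj cs (ω'.concat i) (cs.simple i) 0, cs.rightInvSeq_concat] at h1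
  have h2 := congrArg Prod.snd h1
  simp only [List.concat_eq_append, List.count_append, List.count_eq_zero_of_not_mem hnot',
    List.count_singleton_self] at h2
  have hmem : cs.simple i ∈ cs.rightInvSeq ω := by
    by_contra hcon
    rw [List.count_eq_zero_of_not_mem hcon] at h2
    simp at h2
  obtain ⟨j, hj, hje⟩ := List.mem_iff_getElem.1 hmem
  have hj' : j < ω.length := by simpa using hj
  refine ⟨j, hj', ?_, ?_⟩
  · rw [← cs.wordProd_mul_getD_rightInvSeq, List.getD_eq_getElem _ _ hj, hje]
  · rw [cs.getElem_rightInvSeq ω j hj'] at hje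
    rw [isConj_iff]
    refine ⟨cs.wordProd (ω.drop (j + 1)), ?_⟩
    rw [← hje]
    simp [List.getElem?_eq_getElem hj', mul_assoc]

theorem simple_mul_eq_mul_simple {w : W} {i j : B}
    (h1 : cs.length w < cs.length (cs.simple i * w))
    (h2 : cs.length (cs.simple i * w * cs.simple j) < cs.length (cs.simple i * w))
    (h3 : cs.length w < cs.length (w * cs.simple j)) :
    cs.simple i * w = w * cs.simple j := by
  obtain ⟨ω, hω, rfl⟩ := cs.exists_isReduced w
  rw [← cs.wordProd_cons] at h2
  obtain ⟨k, hk, hke, -⟩ := exists_eraseIdx_of_rightDescent cs h2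
  cases k with
  | zero =>
    rw [cs.wordProd_cons] at hke
    simp only [List.eraseIdx_cons_zero] at hke
    nth_rw 2 [← hke]
    simp
  | succ k =>
    exfalso
    rw [cs.wordProd_cons, List.eraseIdx_cons_succ, cs.wordProd_cons, mul_assoc, mul_right_inj] at hke
    rw [hke, hω.eq] at h3
    have := cs.length_wordProd_le (ω.eraseIdx k)
    have := List.length_eraseIdx_le ω k
    omega

/-! ### Classes of simple reflections and weighted lengths -/

/-- Conjugacy in `W` of the simple reflections, as an equivalence relation on their indices. -/
def simpleSetoid : Setoid B where
  r i j := IsConj (cs.simple i) (cs.simple j)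
  iseqv := ⟨fun _ => IsConj.refl _, IsConj.symm, IsConj.trans⟩

/-- The set of `W`-conjugacy classes of simple reflections. -/
def SimpleClass : Type _ := Quotient (simpleSetoid cs)

/-- The class of a simple reflection. -/
def simpleClass (i : B) : SimpleClass cs := Quotient.mk (simpleSetoid cs) i

theorem simpleClass_eq_iff {i j : B} :
    simpleClass cs i = simpleClass cs j ↔ IsConj (cs.simple i) (cs.simple j) :=
  Quotient.eq (r := simpleSetoid cs)

theorem simpleClass_eq_of_mul_eq {i j : B} {w : W} (h : cs.simple i * w = w * cs.simple j) :
    simpleClass cs i = simpleClass cs j := by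
  rw [simpleClass_eq_iff]
  refine IsConj.symm (isConj_iff.2 ⟨w, ?_⟩)
  rw [← h]; simp

/-- A chosen reduced expression of `w`. -/
noncomputable def reducedWord (w : W) : List B := (cs.exists_isReduced w).choose

theorem isReduced_reducedWord (w : W) : cs.IsReduced (reducedWord cs w) :=
  (cs.exists_isReduced w).choose_spec.1

theorem wordProd_reducedWord (w : W) : cs.wordProd (reducedWord cs w) = w :=
  (cs.exists_isReduced w).choose_spec.2.symm

open Classical in
/-- The number of occurrences of elements of `P` in a reduced expression of `w`. -/
noncomputable def lengthIn (P : Set B) (w : W) : ℕ :=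
  (reducedWord cs w).countP (· ∈ P)

open Classical in
theorem countP_eq_of_isReduced {P : Set B}
    (hP : ∀ i j, IsConj (cs.simple i) (cs.simple j) → (i ∈ P ↔ j ∈ P)) :
    ∀ (n : ℕ) (ω ω' : List B), ω.length = n → cs.IsReduced ω → cs.IsReduced ω' →
      cs.wordProd ω = cs.wordProd ω' → ω.countP (· ∈ P) = ω'.countP (· ∈ P) := by
  intro n
  induction n with
  | zero =>
    intro ω ω' hn h h' e
    have hl : ω'.length = 0 := by rw [← h'.eq, ← e, h.eq, hn]
    rw [List.length_eq_zero_iff] at hn hl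
    rw [hn, hl]
  | succ n ih =>
    intro ω ω' hn h h' e
    obtain rfl | ⟨ν, i, rfl⟩ := List.eq_nil_or_concat ω
    · simp at hn
    have hνl : ν.length = n := by simpa using hn
    have hν : cs.IsReduced ν := by simpa [← hνl] using h.take ν.length
    have hw : cs.wordProd ω' * cs.simple i = cs.wordProd ν := by
      rw [← e, cs.wordProd_concat]; simp
    have hd : cs.length (cs.wordProd ω' * cs.simple i) < cs.length (cs.wordProd ω') := by
      rw [hw, ← e, h.eq, hν.eq]; simp
    obtain ⟨j, hj, hje, hc⟩ := exists_eraseIdx_of_rightDescent cs hd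
    have hl' : ω'.length = n + 1 := by rw [← h'.eq, ← e, h.eq, hn]
    have hr : cs.IsReduced (ω'.eraseIdx j) := by
      rw [CoxeterSystem.IsReduced, ← hje, hw, hν.eq, List.length_eraseIdx_of_lt hj]; omega
    have := ih ν (ω'.eraseIdx j) hνl hν hr (by rw [← hw, hje])
    rw [← (List.getElem_cons_eraseIdx_perm hj).countP_eq, List.concat_eq_append, List.countP_append,
      this,
      List.countP_cons, List.countP_cons, List.countP_nil, zero_add]
    simp only [decide_eq_true_eq]
    rw [if_congr (hP _ _ hc) rfl rfl]

open Classical in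
/-- If `P` is a union of conjugacy classes of simple reflections, `lengthIn cs P` can be computed
with any reduced expression. -/
theorem lengthIn_wordProd {P : Set B}
    (hP : ∀ i j, IsConj (cs.simple i) (cs.simple j) → (i ∈ P ↔ j ∈ P)) {ω : List B}
    (hω : cs.IsReduced ω) : lengthIn cs P (cs.wordProd ω) = ω.countP (· ∈ P) :=
  countP_eq_of_isReduced cs hP _ _ _ rfl (isReduced_reducedWord cs _) hω
    (wordProd_reducedWord cs _)

end Coxeter

section GroupRing

variable (Γ : Type*) [AddCommGroup Γ]

/-- The group ring `ℤ[Γ]`. -/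
abbrev GroupRing : Type _ := AddMonoidAlgebra ℤ Γ

variable {Γ}

/-- The basis element `e^γ` of `ℤ[Γ]`. -/
noncomputable def expG (γ : Γ) : GroupRing Γ := AddMonoidAlgebra.single γ 1

/-- The involution of `ℤ[Γ]` with `e^γ ↦ e^{-γ}`. -/
noncomputable def barG : GroupRing Γ →+* GroupRing Γ :=
  AddMonoidAlgebra.mapDomainRingHom ℤ (negAddMonoidHom : Γ →+ Γ)

theorem barG_expG (γ : Γ) : barG (expG γ) = expG (-γ) := by
  simp [barG, expG]

theorem expG_mul_expG_neg (γ : Γ) : expG γ * expG (-γ) = 1 := by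
  simp [expG, AddMonoidAlgebra.single_mul_single, AddMonoidAlgebra.one_def]

theorem barG_coeff (a : GroupRing Γ) (γ : Γ) : (barG a).coeff γ = a.coeff (-γ) := by
  induction a using AddMonoidAlgebra.induction_linear with
  | zero => simp
  | add x y hx hy => simp [hx, hy]
  | single g r =>
    classical
    simp [barG, Finsupp.single_apply, neg_eq_iff_eq_neg]

theorem barG_barG (a : GroupRing Γ) : barG (barG a) = a := by
  ext γ; simp [barG_coeff]

end GroupRing

section Hecke

variable {B W : Type*} [Group W] {M : CoxeterMatrix B} (cs : CoxeterSystem M W)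
variable {Γ : Type*} [AddCommGroup Γ] (φ : SimpleClass cs → Γ)

/-- The underlying module of the Hecke algebra: the free `ℤ[Γ]`-module on `W`. -/
def Hecke (_φ : SimpleClass cs → Γ) : Type _ := W →₀ GroupRing Γ

noncomputable instance : AddCommGroup (Hecke cs φ) :=
  inferInstanceAs (AddCommGroup (W →₀ GroupRing Γ))

noncomputable instance : Module (GroupRing Γ) (Hecke cs φ) :=
  inferInstanceAs (Module (GroupRing Γ) (W →₀ GroupRing Γ))

/-- The standard basis `(T_w)` of the Hecke algebra. -/
noncomputable def stdBasis : Module.Basis W (GroupRing Γ) (Hecke cs φ) :=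
  Module.Basis.ofRepr (LinearEquiv.refl (GroupRing Γ) (W →₀ GroupRing Γ))

/-- The standard basis element `T_w`. -/
noncomputable def T (w : W) : Hecke cs φ := stdBasis cs φ w

/-- `e^{φ(s)} - e^{-φ(s)}`. -/
noncomputable def xi (i : B) : GroupRing Γ :=
  expG (φ (simpleClass cs i)) - expG (-φ (simpleClass cs i))

open Classical in
/-- Left multiplication by `T_s`. -/
noncomputable def leftOp (i : B) : Module.End (GroupRing Γ) (Hecke cs φ) :=
  (stdBasis cs φ).constr (GroupRing Γ) fun w =>
    if cs.length w < cs.length (cs.simple i * w) then T cs φ (cs.simple i * w)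
    else T cs φ (cs.simple i * w) + xi cs φ i • T cs φ w

open Classical in
/-- Right multiplication by `T_s`. -/
noncomputable def rightOp (i : B) : Module.End (GroupRing Γ) (Hecke cs φ) :=
  (stdBasis cs φ).constr (GroupRing Γ) fun w =>
    if cs.length w < cs.length (w * cs.simple i) then T cs φ (w * cs.simple i)
    else T cs φ (w * cs.simple i) + xi cs φ i • T cs φ w

theorem leftOp_T_of_lt {i : B} {w : W} (h : cs.length w < cs.length (cs.simple i * w)) :
    leftOp cs φ i (T cs φ w) = T cs φ (cs.simple i * w) := by
  rw [leftOp, T, Module.Basis.constr_basis, if_pos h]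

theorem leftOp_T_of_gt {i : B} {w : W} (h : cs.length (cs.simple i * w) < cs.length w) :
    leftOp cs φ i (T cs φ w) = T cs φ (cs.simple i * w) + xi cs φ i • T cs φ w := by
  rw [leftOp, T, Module.Basis.constr_basis, if_neg h.not_gt]
  rfl

theorem rightOp_T_of_lt {i : B} {w : W} (h : cs.length w < cs.length (w * cs.simple i)) :
    rightOp cs φ i (T cs φ w) = T cs φ (w * cs.simple i) := by
  rw [rightOp, T, Module.Basis.constr_basis, if_pos h]

theorem rightOp_T_of_gt {i : B} {w : W} (h : cs.length (w * cs.simple i) < cs.length w) :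
    rightOp cs φ i (T cs φ w) = T cs φ (w * cs.simple i) + xi cs φ i • T cs φ w := by
  rw [rightOp, T, Module.Basis.constr_basis, if_neg h.not_gt]
  rfl

theorem leftOp_rightOp_T (i j : B) (w : W) :
    leftOp cs φ i (rightOp cs φ j (T cs φ w)) = rightOp cs φ j (leftOp cs φ i (T cs φ w)) := by
  have hl := cs.length_simple_mul w i
  have hr := cs.length_mul_simple w j
  have hlr := cs.length_simple_mul (w * cs.simple j) i
  have hrl := cs.length_mul_simple (cs.simple i * w) j
  have hass : cs.simple i * w * cs.simple j = cs.simple i * (w * cs.simple j) := mul_assoc _ _ _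
  have key : cs.simple i * w = w * cs.simple j → xi cs φ i = xi cs φ j := by
    intro h; rw [xi, xi, simpleClass_eq_of_mul_eq cs h]
  rw [hass] at hrl
  rcases hl with hl | hl <;> rcases hr with hr | hr
  · rw [leftOp_T_of_lt cs φ (w := w) (by omega), rightOp_T_of_lt cs φ (w := w) (by omega)]
    rcases hlr with hlr | hlr
    · rw [leftOp_T_of_lt cs φ (by omega), rightOp_T_of_lt cs φ (by rw [hass]; omega), hass]
    · have e := simple_mul_eq_mul_simple cs (w := w) (i := i) (j := j) (by omega)
        (by rw [hass]; omega) (by omega)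
      rw [leftOp_T_of_gt cs φ (by omega), rightOp_T_of_gt cs φ (by rw [hass]; omega), hass, key e,
        e]
  · rw [leftOp_T_of_lt cs φ (w := w) (by omega), rightOp_T_of_gt cs φ (w := w) (by omega),
      map_add, map_smul, leftOp_T_of_lt cs φ (w := w) (by omega),
      leftOp_T_of_lt cs φ (by omega), rightOp_T_of_gt cs φ (by rw [hass]; omega), hass]
  · rw [leftOp_T_of_gt cs φ (w := w) (by omega), rightOp_T_of_lt cs φ (w := w) (by omega),
      map_add, map_smul, rightOp_T_of_lt cs φ (w := w) (by omega),
      leftOp_T_of_gt cs φ (by omega), rightOp_T_of_lt cs φ (by rw [hass]; omega), hass]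
  · rw [leftOp_T_of_gt cs φ (w := w) (by omega), rightOp_T_of_gt cs φ (w := w) (by omega),
      map_add, map_smul, map_add, map_smul, rightOp_T_of_gt cs φ (w := w) (by omega),
      leftOp_T_of_gt cs φ (w := w) (by omega)]
    rcases hlr with hlr | hlr
    · have e := simple_mul_eq_mul_simple cs (w := cs.simple i * w) (i := i) (j := j)
        (by simp; omega) (by simp; omega) (by rw [hass]; omega)
      have e' : cs.simple i * w = w * cs.simple j := by
        rw [cs.simple_mul_simple_cancel_left] at e
        nth_rw 2 [e]
        simp
      rw [leftOp_T_of_lt cs φ (by omega), rightOp_T_of_lt cs φ (by rw [hass]; omega), hass,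
        key e', e']
    · rw [leftOp_T_of_gt cs φ (by omega), rightOp_T_of_gt cs φ (by rw [hass]; omega), hass]
      simp only [smul_add, smul_smul, mul_comm (xi cs φ j)]
      abel

theorem leftOp_rightOp (i j : B) :
    leftOp cs φ i * rightOp cs φ j = rightOp cs φ j * leftOp cs φ i :=
  (stdBasis cs φ).ext fun w => leftOp_rightOp_T cs φ i j w

/-- Left multiplication by `T_w`: the product of the operators attached to the letters of a reduced
expression of `w`. -/
noncomputable def leftOpW (w : W) : Module.End (GroupRing Γ) (Hecke cs φ) :=
  ((reducedWord cs w).map (leftOp cs φ)).prod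

/-- Left multiplication by an arbitrary element. -/
noncomputable def mulLeftOp : Hecke cs φ →ₗ[GroupRing Γ] Module.End (GroupRing Γ) (Hecke cs φ) :=
  (stdBasis cs φ).constr (GroupRing Γ) (leftOpW cs φ)

theorem prod_leftOp_T_one {ω : List B} (h : cs.IsReduced ω) :
    (ω.map (leftOp cs φ)).prod (T cs φ 1) = T cs φ (cs.wordProd ω) := by
  induction ω with
  | nil => simp
  | cons i ω ih =>
    have hω : cs.IsReduced ω := by simpa using h.drop 1
    rw [List.map_cons, List.prod_cons, Module.End.mul_apply, ih hω, leftOp_T_of_lt, cs.wordProd_cons]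
    rw [← cs.wordProd_cons, h.eq, hω.eq]; simp

theorem mulLeftOp_T_one (h : Hecke cs φ) : mulLeftOp cs φ h (T cs φ 1) = h := by
  have : (mulLeftOp cs φ).flip (T cs φ 1) = LinearMap.id := by
    refine (stdBasis cs φ).ext fun w => ?_
    rw [LinearMap.flip_apply, mulLeftOp, Module.Basis.constr_basis, leftOpW,
      prod_leftOp_T_one cs φ (isReduced_reducedWord cs w), wordProd_reducedWord]
    rfl
  exact LinearMap.congr_fun this h

/-- An operator commuting with all right multiplications is determined by its value at `T_1`. -/
theorem op_ext {f g : Module.End (GroupRing Γ) (Hecke cs φ)}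
    (hf : ∀ i, Commute f (rightOp cs φ i)) (hg : ∀ i, Commute g (rightOp cs φ i))
    (h : f (T cs φ 1) = g (T cs φ 1)) : f = g := by
  have key : ∀ (n : ℕ) (w : W), cs.length w = n → f (T cs φ w) = g (T cs φ w) := by
    intro n
    induction n with
    | zero =>
      intro w hw
      rw [cs.length_eq_zero_iff] at hw
      rw [hw, h]
    | succ n ih =>
      intro w hw
      obtain ⟨i, hi⟩ := cs.exists_rightDescent_of_ne_one (w := w) (by
        rintro rfl; simp at hw)
      have hi' : cs.length (w * cs.simple i) < cs.length w := hi
      have hn : cs.length (w * cs.simple i) = n := by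
        have := cs.length_mul_simple w i
        omega
      have e : T cs φ w = rightOp cs φ i (T cs φ (w * cs.simple i)) := by
        rw [rightOp_T_of_lt cs φ (by simpa using hi')]; simp
      have h1 := LinearMap.congr_fun (hf i) (T cs φ (w * cs.simple i))
      have h2 := LinearMap.congr_fun (hg i) (T cs φ (w * cs.simple i))
      rw [Module.End.mul_apply, Module.End.mul_apply] at h1 h2
      rw [e, h1, h2, ih _ hn]
  exact (stdBasis cs φ).ext fun w => key _ w rfl

theorem commute_mulLeftOp (h : Hecke cs φ) (j : B) :
    Commute (mulLeftOp cs φ h) (rightOp cs φ j) := by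
  rw [mulLeftOp, Module.Basis.constr_apply, Finsupp.sum]
  refine Commute.sum_left _ _ _ fun w _ => Commute.smul_left ?_ _
  refine Commute.list_prod_left _ _ fun f hf => ?_
  obtain ⟨i, -, rfl⟩ := List.mem_map.1 hf
  exact leftOp_rightOp cs φ i j

noncomputable instance : Mul (Hecke cs φ) := ⟨fun h h' => mulLeftOp cs φ h h'⟩

noncomputable instance : One (Hecke cs φ) := ⟨T cs φ 1⟩

theorem mul_def (h h' : Hecke cs φ) : h * h' = mulLeftOp cs φ h h' := rfl

theorem one_def : (1 : Hecke cs φ) = T cs φ 1 := rfl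

theorem mulLeftOp_mul (h h' : Hecke cs φ) :
    mulLeftOp cs φ (h * h') = mulLeftOp cs φ h * mulLeftOp cs φ h' := by
  refine op_ext cs φ (commute_mulLeftOp cs φ _)
    (fun i => (commute_mulLeftOp cs φ h i).mul_left (commute_mulLeftOp cs φ h' i)) ?_
  rw [mulLeftOp_T_one, Module.End.mul_apply, mulLeftOp_T_one, mul_def]

theorem mulLeftOp_one : mulLeftOp cs φ 1 = 1 := by
  refine op_ext cs φ (commute_mulLeftOp cs φ _) (fun i => Commute.one_left _) ?_
  rw [mulLeftOp_T_one, one_def, Module.End.one_apply]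

/-- The Hecke algebra is a ring. -/
noncomputable instance : Ring (Hecke cs φ) :=
  { (inferInstance : AddCommGroup (Hecke cs φ)), (inferInstance : Mul (Hecke cs φ)),
    (inferInstance : One (Hecke cs φ)) with
    left_distrib := fun a b c => by simp only [mul_def, map_add]
    right_distrib := fun a b c => by simp only [mul_def, map_add, LinearMap.add_apply]
    zero_mul := fun a => by simp only [mul_def, map_zero, LinearMap.zero_apply]
    mul_zero := fun a => by simp only [mul_def, map_zero]
    mul_assoc := fun a b c => by
      rw [mul_def cs φ (a * b) c, mulLeftOp_mul, Module.End.mul_apply, ← mul_def, ← mul_def]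
    one_mul := fun a => by rw [mul_def, mulLeftOp_one, Module.End.one_apply]
    mul_one := fun a => by rw [mul_def, one_def, mulLeftOp_T_one] }

/-- The Hecke algebra is an algebra over `ℤ[Γ]`. -/
noncomputable instance : Algebra (GroupRing Γ) (Hecke cs φ) :=
  Algebra.ofModule (fun r x y => by simp only [mul_def, map_smul, LinearMap.smul_apply])
    (fun r x y => by simp only [mul_def, map_smul])

/-! ### The defining relations -/

theorem T_one : T cs φ 1 = 1 := rfl

theorem mulLeftOp_T_simple (i : B) : mulLeftOp cs φ (T cs φ (cs.simple i)) = leftOp cs φ i := by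
  refine op_ext cs φ (commute_mulLeftOp cs φ _) (fun j => leftOp_rightOp cs φ i j) ?_
  rw [mulLeftOp_T_one, leftOp_T_of_lt cs φ (by simp)]; simp

theorem T_simple_mul_of_lt {i : B} {w : W} (h : cs.length w < cs.length (cs.simple i * w)) :
    T cs φ (cs.simple i) * T cs φ w = T cs φ (cs.simple i * w) := by
  rw [mul_def, mulLeftOp_T_simple, leftOp_T_of_lt cs φ h]

theorem T_simple_mul_of_gt {i : B} {w : W} (h : cs.length (cs.simple i * w) < cs.length w) :
    T cs φ (cs.simple i) * T cs φ w = T cs φ (cs.simple i * w) + xi cs φ i • T cs φ w := by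
  rw [mul_def, mulLeftOp_T_simple, leftOp_T_of_gt cs φ h]

theorem T_mul_T {w w' : W} (h : cs.length (w * w') = cs.length w + cs.length w') :
    T cs φ w * T cs φ w' = T cs φ (w * w') := by
  induction hn : cs.length w generalizing w with
  | zero =>
    rw [cs.length_eq_zero_iff] at hn
    rw [hn, T_one, one_mul, one_mul]
  | succ n ih =>
    obtain ⟨i, hi⟩ := cs.exists_leftDescent_of_ne_one (w := w) (by rintro rfl; simp at hn)
    have hi' : cs.length (cs.simple i * w) < cs.length w := hi
    obtain ⟨v, rfl⟩ : ∃ v, w = cs.simple i * v := ⟨cs.simple i * w, by simp⟩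
    rw [cs.simple_mul_simple_cancel_left] at hi'
    have h1 := cs.length_simple_mul v i
    have h2 := cs.length_simple_mul (v * w') i
    have h3 := cs.length_mul_le v w'
    rw [← mul_assoc] at h2
    rw [← T_simple_mul_of_lt cs φ hi', mul_assoc, ih (by omega) (by omega),
      T_simple_mul_of_lt cs φ (by rw [← mul_assoc]; omega), mul_assoc]

theorem T_simple_sq (i : B) :
    T cs φ (cs.simple i) * T cs φ (cs.simple i) = 1 + xi cs φ i • T cs φ (cs.simple i) := by
  rw [T_simple_mul_of_gt cs φ (by simp)]; simp [T_one]

theorem T_simple_quadratic (i : B) :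
    (T cs φ (cs.simple i) - algebraMap _ _ (expG (φ (simpleClass cs i)))) *
      (T cs φ (cs.simple i) + algebraMap _ _ (expG (-φ (simpleClass cs i)))) = 0 := by
  rw [sub_mul, mul_add, mul_add, T_simple_sq, ← map_mul, expG_mul_expG_neg, map_one,
    ← Algebra.commutes, xi, sub_smul, Algebra.smul_def, Algebra.smul_def]
  abel

end Hecke

section Bar

variable {B W : Type*} [Group W] {M : CoxeterMatrix B} (cs : CoxeterSystem M W)
variable {Γ : Type*} [AddCommGroup Γ] (φ : SimpleClass cs → Γ)

/-- `T_s - (e^{φ(s)} - e^{-φ(s)})`, the inverse of `T_s`. -/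
noncomputable def TsInv (i : B) : Hecke cs φ :=
  T cs φ (cs.simple i) - xi cs φ i • 1

theorem T_simple_mul_TsInv (i : B) : T cs φ (cs.simple i) * TsInv cs φ i = 1 := by
  rw [TsInv, mul_sub, T_simple_sq, mul_smul_comm, mul_one, add_sub_cancel_right]

theorem TsInv_mul_T_simple (i : B) : TsInv cs φ i * T cs φ (cs.simple i) = 1 := by
  rw [TsInv, sub_mul, T_simple_sq, smul_mul_assoc, one_mul, add_sub_cancel_right]

theorem isUnit_T (w : W) : IsUnit (T cs φ w) := by
  induction hn : cs.length w generalizing w with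
  | zero =>
    rw [cs.length_eq_zero_iff] at hn
    rw [hn, T_one]; exact isUnit_one
  | succ n ih =>
    obtain ⟨i, hi⟩ := cs.exists_leftDescent_of_ne_one (w := w) (by rintro rfl; simp at hn)
    have hi' : cs.length (cs.simple i * w) < cs.length w := hi
    have h1 := cs.length_simple_mul w i
    have h2 := T_simple_mul_of_lt cs φ (i := i) (w := cs.simple i * w) (by simpa using hi')
    rw [cs.simple_mul_simple_cancel_left] at h2
    rw [← h2]
    exact IsUnit.mul ⟨⟨_, _, T_simple_mul_TsInv cs φ i, TsInv_mul_T_simple cs φ i⟩, rfl⟩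
      (ih _ (by omega))

/-- `\overline{T_w} = T_{w⁻¹}⁻¹`. -/
noncomputable def barT (w : W) : Hecke cs φ := ((isUnit_T cs φ w⁻¹).unit⁻¹ : (Hecke cs φ)ˣ)

/-- The bar involution `∑ a_w T_w ↦ ∑ \overline{a_w} T_{w⁻¹}⁻¹`. -/
noncomputable def bar (h : Hecke cs φ) : Hecke cs φ :=
  ((stdBasis cs φ).repr h).sum fun w a => barG a • barT cs φ w

theorem barT_eq_of_mul {w : W} {x : Hecke cs φ} (h : x * T cs φ w⁻¹ = 1) :
    barT cs φ w = x := by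
  exact Units.inv_eq_of_mul_eq_one_left h

theorem barT_mul (w : W) : barT cs φ w * T cs φ w⁻¹ = 1 := by
  rw [barT]; exact (isUnit_T cs φ w⁻¹).val_inv_mul

theorem barT_one : barT cs φ 1 = 1 := barT_eq_of_mul cs φ (by rw [inv_one, T_one, mul_one])

theorem barT_simple_mul {i : B} {w : W} (h : cs.length w < cs.length (cs.simple i * w)) :
    barT cs φ (cs.simple i * w) = TsInv cs φ i * barT cs φ w := by
  apply barT_eq_of_mul
  have h1 := cs.length_simple_mul w i
  have : T cs φ (cs.simple i * w)⁻¹ = T cs φ w⁻¹ * T cs φ (cs.simple i) := by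
    rw [T_mul_T]
    · simp
    · rw [← cs.inv_simple i, ← mul_inv_rev, cs.length_inv, cs.length_inv, cs.length_inv,
        cs.length_simple]
      omega
  rw [this, mul_assoc, ← mul_assoc _ (T cs φ w⁻¹), barT_mul, one_mul, TsInv_mul_T_simple]

theorem bar_add (x y : Hecke cs φ) : bar cs φ (x + y) = bar cs φ x + bar cs φ y := by
  rw [bar, map_add, Finsupp.sum_add_index'] <;> simp [bar, add_smul]

theorem bar_zero : bar cs φ 0 = 0 := by simp [bar]

theorem bar_smul (a : GroupRing Γ) (x : Hecke cs φ) :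
    bar cs φ (a • x) = barG a • bar cs φ x := by
  rw [bar, map_smul, Finsupp.sum_smul_index' (by simp), bar, Finsupp.smul_sum]
  simp [mul_smul]

theorem bar_neg (x : Hecke cs φ) : bar cs φ (-x) = -bar cs φ x := by
  rw [← neg_one_smul (GroupRing Γ), bar_smul]; simp

theorem bar_sub (x y : Hecke cs φ) : bar cs φ (x - y) = bar cs φ x - bar cs φ y := by
  rw [sub_eq_add_neg, bar_add, bar_neg, sub_eq_add_neg]

theorem bar_T (w : W) : bar cs φ (T cs φ w) = barT cs φ w := by
  rw [bar, T, Module.Basis.repr_self, Finsupp.sum_single_index] <;> simp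

theorem hecke_induction {p : Hecke cs φ → Prop} (zero : p 0) (add : ∀ x y, p x → p y → p (x + y))
    (smul : ∀ (a : GroupRing Γ) w, p (a • T cs φ w)) (h : Hecke cs φ) : p h := by
  rw [← (stdBasis cs φ).linearCombination_repr h, Finsupp.linearCombination_apply]
  exact Finset.sum_induction _ p add zero fun w _ => smul _ w

theorem barG_xi (i : B) : barG (xi cs φ i) = -xi cs φ i := by
  rw [xi, map_sub, barG_expG, barG_expG]; simp

theorem bar_T_simple_mul (i : B) (h : Hecke cs φ) :
    bar cs φ (T cs φ (cs.simple i) * h) = TsInv cs φ i * bar cs φ h := by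
  induction h using hecke_induction with
  | zero => simp [bar_zero]
  | add x y hx hy => rw [mul_add, bar_add, bar_add, mul_add, hx, hy]
  | smul a w =>
    rw [mul_smul_comm, bar_smul, bar_smul, mul_smul_comm]
    congr 1
    rcases cs.length_simple_mul w i with hl | hl
    · rw [T_simple_mul_of_lt cs φ (by omega), bar_T, bar_T, barT_simple_mul cs φ (by omega)]
    · rw [T_simple_mul_of_gt cs φ (by omega), bar_add, bar_smul, bar_T, bar_T]
      have e := barT_simple_mul cs φ (i := i) (w := cs.simple i * w) (by simp; omega)
      rw [cs.simple_mul_simple_cancel_left] at e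
      have e' : TsInv cs φ i * TsInv cs φ i = 1 - xi cs φ i • TsInv cs φ i := by
        nth_rw 1 [TsInv]
        rw [sub_mul, T_simple_mul_TsInv, smul_mul_assoc, one_mul]
      rw [e, ← mul_assoc, e', barG_xi, sub_mul, one_mul, neg_smul, smul_mul_assoc, sub_eq_add_neg]

theorem bar_bar (h : Hecke cs φ) : bar cs φ (bar cs φ h) = h := by
  induction h using hecke_induction with
  | zero => simp [bar_zero]
  | add x y hx hy => rw [bar_add, bar_add, hx, hy]
  | smul a w =>
    rw [bar_smul, bar_smul, barG_barG]
    congr 1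
    induction hn : cs.length w generalizing w with
    | zero =>
      rw [cs.length_eq_zero_iff] at hn
      rw [hn, bar_T, barT_one, ← T_one, bar_T, barT_one, T_one]
    | succ n ih =>
      obtain ⟨i, hi⟩ := cs.exists_leftDescent_of_ne_one (w := w) (by rintro rfl; simp at hn)
      have hi' : cs.length (cs.simple i * w) < cs.length w := hi
      have h1 := cs.length_simple_mul w i
      have h2 := T_simple_mul_of_lt cs φ (i := i) (w := cs.simple i * w) (by simpa using hi')
      rw [cs.simple_mul_simple_cancel_left] at h2
      have h3 := ih (cs.simple i * w) (by omega)
      rw [← h2, bar_T_simple_mul]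
      nth_rw 1 [TsInv]
      rw [sub_mul, bar_sub, bar_T_simple_mul, smul_mul_assoc, one_mul, bar_smul, h3, barG_xi, TsInv,
        sub_mul, smul_mul_assoc, one_mul, neg_smul]
      abel

/-! ### Triangularity of the bar involution -/

/-- The span of the `T_y` with `ℓ(y) < n`. -/
noncomputable def shorter (n : ℕ) : Submodule (GroupRing Γ) (Hecke cs φ) :=
  Submodule.span (GroupRing Γ) (T cs φ '' {y | cs.length y < n})

theorem T_mem_shorter {n : ℕ} {y : W} (h : cs.length y < n) : T cs φ y ∈ shorter cs φ n :=
  Submodule.subset_span ⟨y, h, rfl⟩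

theorem shorter_mono {m n : ℕ} (h : m ≤ n) : shorter cs φ m ≤ shorter cs φ n :=
  Submodule.span_mono (Set.image_mono fun _ hy => lt_of_lt_of_le hy h)

theorem mem_shorter_iff {n : ℕ} {h : Hecke cs φ} :
    h ∈ shorter cs φ n ↔ ∀ y, n ≤ cs.length y → (stdBasis cs φ).repr h y = 0 := by
  have : shorter cs φ n =
      Submodule.span (GroupRing Γ) (stdBasis cs φ '' {y | cs.length y < n}) := rfl
  rw [this, Module.Basis.mem_span_image]
  constructor
  · intro hs y hy
    by_contra hne
    have := hs (Finsupp.mem_support_iff.2 hne)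
    simp only [Set.mem_ofPred_eq] at this
    omega
  · intro hs y hy
    by_contra hne
    exact Finsupp.mem_support_iff.1 hy (hs y (by simpa using hne))

theorem T_simple_mul_mem_shorter (i : B) {n : ℕ} {h : Hecke cs φ} (hh : h ∈ shorter cs φ n) :
    T cs φ (cs.simple i) * h ∈ shorter cs φ (n + 1) := by
  induction hh using Submodule.span_induction with
  | zero => simp
  | add x y _ _ hx hy => rw [mul_add]; exact add_mem hx hy
  | smul a x _ hx => rw [mul_smul_comm]; exact Submodule.smul_mem _ _ hx
  | mem x hx =>
    obtain ⟨y, hy, rfl⟩ := hx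
    simp only [Set.mem_ofPred_eq] at hy
    rcases cs.length_simple_mul y i with hl | hl
    · rw [T_simple_mul_of_lt cs φ (by omega)]
      exact T_mem_shorter cs φ (by omega)
    · rw [T_simple_mul_of_gt cs φ (by omega)]
      exact add_mem (T_mem_shorter cs φ (by omega))
        (Submodule.smul_mem _ _ (T_mem_shorter cs φ (by omega)))

theorem bar_T_sub_mem (w : W) : bar cs φ (T cs φ w) - T cs φ w ∈ shorter cs φ (cs.length w) := by
  induction hn : cs.length w generalizing w with
  | zero =>
    rw [cs.length_eq_zero_iff] at hn
    rw [hn, bar_T, barT_one, T_one, sub_self]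
    exact zero_mem _
  | succ n ih =>
    obtain ⟨i, hi⟩ := cs.exists_leftDescent_of_ne_one (w := w) (by rintro rfl; simp at hn)
    have hi' : cs.length (cs.simple i * w) < cs.length w := hi
    have h1 := cs.length_simple_mul w i
    have h2 := T_simple_mul_of_lt cs φ (i := i) (w := cs.simple i * w) (by simpa using hi')
    rw [cs.simple_mul_simple_cancel_left] at h2
    have h3 := ih (cs.simple i * w) (by omega)
    have h4 := T_simple_mul_mem_shorter cs φ i h3
    have h5 : bar cs φ (T cs φ (cs.simple i * w)) ∈ shorter cs φ (n + 1) := by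
      rw [← sub_add_cancel (bar cs φ (T cs φ (cs.simple i * w))) (T cs φ (cs.simple i * w))]
      exact add_mem (shorter_mono cs φ (by omega) h3) (T_mem_shorter cs φ (by omega))
    rw [← h2, bar_T_simple_mul, TsInv, sub_mul, smul_mul_assoc, one_mul]
    have : T cs φ (cs.simple i) * bar cs φ (T cs φ (cs.simple i * w)) -
        xi cs φ i • bar cs φ (T cs φ (cs.simple i * w)) -
        T cs φ (cs.simple i) * T cs φ (cs.simple i * w) =
        T cs φ (cs.simple i) * (bar cs φ (T cs φ (cs.simple i * w)) - T cs φ (cs.simple i * w)) -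
        xi cs φ i • bar cs φ (T cs φ (cs.simple i * w)) := by
      rw [mul_sub]; abel
    rw [this]
    exact sub_mem h4 (Submodule.smul_mem _ _ h5)

theorem bar_mem_shorter {n : ℕ} {h : Hecke cs φ} (hh : h ∈ shorter cs φ n) :
    bar cs φ h ∈ shorter cs φ n := by
  induction hh using Submodule.span_induction with
  | zero => simp [bar_zero]
  | add x y _ _ hx hy => rw [bar_add]; exact add_mem hx hy
  | smul a x _ hx => rw [bar_smul]; exact Submodule.smul_mem _ _ hx
  | mem x hx =>
    obtain ⟨y, hy, rfl⟩ := hx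
    simp only [Set.mem_ofPred_eq] at hy
    rw [← sub_add_cancel (bar cs φ (T cs φ y)) (T cs φ y)]
    exact add_mem (shorter_mono cs φ (by omega) (bar_T_sub_mem cs φ y)) (T_mem_shorter cs φ hy)

/-- The coefficient of a longest term is conjugated by the bar involution. -/
theorem repr_bar_of_mem_shorter {n : ℕ} {h : Hecke cs φ} (hh : h ∈ shorter cs φ (n + 1)) {y : W}
    (hy : cs.length y = n) :
    (stdBasis cs φ).repr (bar cs φ h) y = barG ((stdBasis cs φ).repr h y) := by
  induction hh using Submodule.span_induction with
  | zero => simp [bar_zero]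
  | add x z _ _ hx hz => simp [bar_add, hx, hz]
  | smul a x _ hx => simp [bar_smul, hx]
  | mem x hx =>
    obtain ⟨z, hz, rfl⟩ := hx
    simp only [Set.mem_ofPred_eq] at hz
    have h1 := (mem_shorter_iff cs φ).1 (bar_T_sub_mem cs φ z) y (by omega)
    rw [map_sub, Finsupp.sub_apply, sub_eq_zero] at h1
    classical
    rw [h1, T, Module.Basis.repr_self, Finsupp.single_apply]
    split_ifs <;> simp

theorem exists_mem_shorter (h : Hecke cs φ) : ∃ n, h ∈ shorter cs φ n := by
  refine ⟨((stdBasis cs φ).repr h).support.sup cs.length + 1, ?_⟩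
  rw [mem_shorter_iff]
  intro y hy
  by_contra hne
  have := Finset.le_sup (f := cs.length) (Finsupp.mem_support_iff.2 hne)
  omega

theorem eq_zero_of_mem_shorter_zero {h : Hecke cs φ} (hh : h ∈ shorter cs φ 0) : h = 0 := by
  rw [mem_shorter_iff] at hh
  apply (stdBasis cs φ).repr.injective
  ext1 y
  rw [hh y (Nat.zero_le _)]; simp

end Bar

section KL

variable {Γ : Type*} [AddCommGroup Γ] [LinearOrder Γ]

variable (Γ) in
/-- `ℤ[Γ_{<0}]`. -/
def negG : AddSubgroup (GroupRing Γ) where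
  carrier := {a | ∀ γ, a.coeff γ ≠ 0 → γ < 0}
  zero_mem' := fun γ h => absurd rfl h
  add_mem' := by
    intro a b ha hb γ h
    by_cases h1 : a.coeff γ = 0
    · exact hb γ fun h2 => h (by simp [h1, h2])
    · exact ha γ h1
  neg_mem' := by
    intro a ha γ h
    exact ha γ fun h1 => h (by simp [h1])

theorem mem_negG {a : GroupRing Γ} : a ∈ negG Γ ↔ ∀ γ, a.coeff γ ≠ 0 → γ < 0 := Iff.rfl

/-- The part of an element of `ℤ[Γ]` supported on negative exponents. -/
noncomputable def negPartG (a : GroupRing Γ) : GroupRing Γ :=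
  AddMonoidAlgebra.ofCoeff (a.coeff.filter (· < 0))

theorem negPartG_coeff (a : GroupRing Γ) (γ : Γ) :
    (negPartG a).coeff γ = if γ < 0 then a.coeff γ else 0 := by
  rw [negPartG, AddMonoidAlgebra.coeff_ofCoeff, Finsupp.filter_apply]

theorem negPartG_zero : negPartG (0 : GroupRing Γ) = 0 := by
  ext γ; simp [negPartG_coeff]

theorem negPartG_mem (a : GroupRing Γ) : negPartG a ∈ negG Γ := by
  intro γ h
  rw [negPartG_coeff] at h
  by_contra hc
  exact h (if_neg hc)

variable [IsOrderedAddMonoid Γ]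

theorem negPartG_sub_bar {a : GroupRing Γ} (h : barG a = -a) :
    negPartG a - barG (negPartG a) = a := by
  ext γ
  have h1 : a.coeff (-γ) = -a.coeff γ := by rw [← barG_coeff, h]; simp
  rw [AddMonoidAlgebra.coeff_sub, Finsupp.sub_apply, barG_coeff, negPartG_coeff, negPartG_coeff, h1]
  rcases lt_trichotomy γ 0 with hγ | hγ | hγ
  · rw [if_pos hγ, if_neg (by simpa using hγ.le)]; simp
  · subst hγ
    rw [neg_zero] at h1 ⊢
    simp only [lt_irrefl, if_false]
    omega
  · rw [if_neg hγ.not_gt, if_pos (by simpa using hγ)]; simp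

theorem eq_zero_of_mem_negG {a : GroupRing Γ} (ha : a ∈ negG Γ) (h : barG a = a) : a = 0 := by
  ext γ
  by_contra hne
  have hne' : a.coeff γ ≠ 0 := hne
  have h1 := ha γ hne'
  have h2 := ha (-γ) (by rwa [← barG_coeff, h])
  rw [neg_lt_zero] at h2
  exact lt_asymm h1 h2

variable {B W : Type*} [Group W] {M : CoxeterMatrix B} (cs : CoxeterSystem M W)
variable (φ : SimpleClass cs → Γ)

/-- `H_{<0}`: the elements all of whose coordinates on the standard basis lie in `ℤ[Γ_{<0}]`. -/
def heckeNeg : AddSubgroup (Hecke cs φ) where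
  carrier := {h | ∀ w, (stdBasis cs φ).repr h w ∈ negG Γ}
  zero_mem' := fun w => by simp [zero_mem]
  add_mem' := fun ha hb w => by
    rw [map_add, Finsupp.add_apply]; exact add_mem (ha w) (hb w)
  neg_mem' := fun ha w => by
    rw [map_neg, Finsupp.neg_apply]; exact neg_mem (ha w)

theorem eq_zero_of_mem_heckeNeg {p : Hecke cs φ} (hp : p ∈ heckeNeg cs φ)
    (h : bar cs φ p = p) : p = 0 := by
  obtain ⟨n, hn⟩ := exists_mem_shorter cs φ p
  induction n with
  | zero => exact eq_zero_of_mem_shorter_zero cs φ hn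
  | succ n ih =>
    apply ih
    rw [mem_shorter_iff]
    intro y hy
    rcases hy.eq_or_lt with hy | hy
    · have h1 := repr_bar_of_mem_shorter cs φ hn hy.symm
      rw [h] at h1
      exact eq_zero_of_mem_negG (hp y) h1.symm
    · exact (mem_shorter_iff cs φ).1 hn y hy

theorem exists_sub_bar (n : ℕ) : ∀ d ∈ shorter cs φ n, bar cs φ d = -d →
    ∃ p ∈ shorter cs φ n, p ∈ heckeNeg cs φ ∧ p - bar cs φ p = d := by
  induction n with
  | zero =>
    intro d hd _
    exact ⟨0, zero_mem _, zero_mem _, by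
      rw [eq_zero_of_mem_shorter_zero cs φ hd, bar_zero, sub_zero]⟩
  | succ n ih =>
    intro d hd hbar
    obtain ⟨q, hq⟩ : ∃ q : Hecke cs φ, ∀ y, (stdBasis cs φ).repr q y =
        negPartG ((stdBasis cs φ).repr d y) :=
      ⟨(stdBasis cs φ).repr.symm
        (((stdBasis cs φ).repr d).mapRange negPartG negPartG_zero), fun y => by simp⟩
    have hqs : q ∈ shorter cs φ (n + 1) := by
      rw [mem_shorter_iff]
      intro y hy
      rw [hq, (mem_shorter_iff cs φ).1 hd y hy, negPartG_zero]
    have hqn : q ∈ heckeNeg cs φ := fun y => by rw [hq]; exact negPartG_mem _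
    obtain ⟨p, hps, hpn, hpd⟩ := ih (d - (q - bar cs φ q)) (by
      rw [mem_shorter_iff]
      intro y hy
      rcases hy.eq_or_lt with hy | hy
      · have h1 := repr_bar_of_mem_shorter cs φ hd hy.symm
        rw [hbar, map_neg, Finsupp.neg_apply] at h1
        rw [map_sub, map_sub, Finsupp.sub_apply, Finsupp.sub_apply,
          repr_bar_of_mem_shorter cs φ hqs hy.symm, hq, negPartG_sub_bar h1.symm, sub_self]
      · exact (mem_shorter_iff cs φ).1
          (sub_mem hd (sub_mem hqs (bar_mem_shorter cs φ hqs))) y hy) (by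
      rw [bar_sub, bar_sub, bar_bar, hbar]; abel)
    refine ⟨p + q, add_mem (shorter_mono cs φ (Nat.le_succ n) hps) hqs, add_mem hpn hqn, ?_⟩
    rw [bar_add, add_sub_add_comm, hpd]; abel

/-- `c` is bar-invariant and congruent to `T_w` modulo `H_{<0}`. -/
def IsKLElement (w : W) (c : Hecke cs φ) : Prop :=
  bar cs φ c = c ∧ c - T cs φ w ∈ heckeNeg cs φ

theorem exists_isKLElement (w : W) :
    ∃ c, IsKLElement cs φ w c ∧ c - T cs φ w ∈ shorter cs φ (cs.length w) := by
  obtain ⟨p, hps, hpn, hpd⟩ := exists_sub_bar cs φ (cs.length w)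
    (bar cs φ (T cs φ w) - T cs φ w) (bar_T_sub_mem cs φ w) (by
      rw [bar_sub, bar_bar]; abel)
  refine ⟨T cs φ w + p, ⟨?_, by simpa using hpn⟩, by simpa using hps⟩
  rw [sub_eq_sub_iff_add_eq_add] at hpd
  rw [bar_add, ← hpd, add_comm]

theorem isKLElement_unique {w : W} {c c' : Hecke cs φ} (h : IsKLElement cs φ w c)
    (h' : IsKLElement cs φ w c') : c = c' := by
  rw [← sub_eq_zero]
  apply eq_zero_of_mem_heckeNeg cs φ
  · have := sub_mem h.2 h'.2
    rwa [sub_sub_sub_cancel_right] at this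
  · rw [bar_sub, h.1, h'.1]

theorem existsUnique_isKLElement (w : W) : ∃! c, IsKLElement cs φ w c := by
  obtain ⟨c, hc, -⟩ := exists_isKLElement cs φ w
  exact ⟨c, hc, fun c' hc' => isKLElement_unique cs φ hc' hc⟩

/-- The Kazhdan–Lusztig element `C_w`. -/
noncomputable def C (w : W) : Hecke cs φ := (existsUnique_isKLElement cs φ w).choose

theorem isKLElement_C (w : W) : IsKLElement cs φ w (C cs φ w) :=
  (existsUnique_isKLElement cs φ w).choose_spec.1

theorem C_sub_T_mem (w : W) : C cs φ w - T cs φ w ∈ shorter cs φ (cs.length w) := by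
  obtain ⟨c, hc, hcs⟩ := exists_isKLElement cs φ w
  rwa [isKLElement_unique cs φ (isKLElement_C cs φ w) hc]

/-- The linear map `T_w ↦ C_w`. -/
noncomputable def klMap : Hecke cs φ →ₗ[GroupRing Γ] Hecke cs φ :=
  (stdBasis cs φ).constr (GroupRing Γ) (C cs φ)

theorem klMap_T (w : W) : klMap cs φ (T cs φ w) = C cs φ w :=
  Module.Basis.constr_basis _ _ _ _

theorem klMap_sub_mem {n : ℕ} {h : Hecke cs φ} (hh : h ∈ shorter cs φ (n + 1)) :
    klMap cs φ h - h ∈ shorter cs φ n := by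
  induction hh using Submodule.span_induction with
  | zero => simp
  | add x y _ _ hx hy => rw [map_add, add_sub_add_comm]; exact add_mem hx hy
  | smul a x _ hx => rw [map_smul, ← smul_sub]; exact Submodule.smul_mem _ _ hx
  | mem x hx =>
    obtain ⟨y, hy, rfl⟩ := hx
    simp only [Set.mem_ofPred_eq] at hy
    rw [klMap_T]
    exact shorter_mono cs φ (by omega) (C_sub_T_mem cs φ y)

theorem klMap_bijective : Function.Bijective (klMap cs φ) := by
  constructor
  · rw [injective_iff_map_eq_zero]
    intro h hh
    obtain ⟨n, hn⟩ := exists_mem_shorter cs φ h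
    induction n with
    | zero => exact eq_zero_of_mem_shorter_zero cs φ hn
    | succ n ih =>
      apply ih
      have := klMap_sub_mem cs φ hn
      rw [hh, zero_sub] at this
      simpa using this
  · intro h
    obtain ⟨n, hn⟩ := exists_mem_shorter cs φ h
    induction n generalizing h with
    | zero => exact ⟨0, by rw [eq_zero_of_mem_shorter_zero cs φ hn, map_zero]⟩
    | succ n ih =>
      obtain ⟨g, hg⟩ := ih _ (klMap_sub_mem cs φ hn)
      exact ⟨h - g, by rw [map_sub, hg]; abel⟩

/-- The Kazhdan–Lusztig basis `(C_w)`. -/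
noncomputable def klBasis : Module.Basis W (GroupRing Γ) (Hecke cs φ) :=
  (stdBasis cs φ).map (LinearEquiv.ofBijective (klMap cs φ) (klMap_bijective cs φ))

theorem klBasis_apply (w : W) : klBasis cs φ w = C cs φ w := by
  rw [klBasis, Module.Basis.map_apply]
  exact klMap_T cs φ w

/-! ### Preorders and cells -/

/-- The three kinds of cells: left, right and two-sided. -/
inductive Side
  | L
  | R
  | LR

/-- `x ←_{?} y`: there is `h` such that `C_x` has a non-zero coefficient in `h C_y` (for `L`), in
`C_y h` (for `R`), in `h C_y` or `C_y h` (for `LR`). -/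
def Arrow : Side → W → W → Prop
  | .L, x, y => ∃ h, (klBasis cs φ).repr (h * C cs φ y) x ≠ 0
  | .R, x, y => ∃ h, (klBasis cs φ).repr (C cs φ y * h) x ≠ 0
  | .LR, x, y => ∃ h, (klBasis cs φ).repr (h * C cs φ y) x ≠ 0 ∨
      (klBasis cs φ).repr (C cs φ y * h) x ≠ 0

/-- The preorder `≤_?`: the transitive closure of `←_?`. -/
def CellLE (d : Side) : W → W → Prop := Relation.TransGen (Arrow cs φ d)

/-- The equivalence relation `∼_?` associated with `≤_?`; its classes are the cells. -/
def CellEquiv (d : Side) (x y : W) : Prop := CellLE cs φ d x y ∧ CellLE cs φ d y x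

end KL

section Sign

variable {B W : Type*} [Group W] {M : CoxeterMatrix B} (cs : CoxeterSystem M W)
variable {Γ : Type*} [AddCommGroup Γ]

/-- The linear map `θ : H(W,S,φ) → H(W,S,φ')` with `θ(T_w) = (-1)^{ℓ_P(w)} T_w`, where `ℓ_P(w)` is
the number of letters in `P` of a reduced expression of `w`. -/
noncomputable def theta (P : Set B) (φ φ' : SimpleClass cs → Γ) :
    Hecke cs φ →ₗ[GroupRing Γ] Hecke cs φ' :=
  (stdBasis cs φ).constr (GroupRing Γ) fun w => (-1 : GroupRing Γ) ^ lengthIn cs P w • T cs φ' w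

end Sign

end KazhdanLusztig

/-! Write `ε(w) = (-1)^{ℓ_-(w)}`. Since `S_-` is a union of conjugacy classes of simple reflections,
`ε` is a character of `W`: `ε(sw) = ε(s) ε(w)` whether or not `s` lengthens `w`
(`signLength_simple_mul`). The relation `T_s² = 1 + ξ_s T_s` depends on `φ` only through `ξ_s =
e^{φ(s)} - e^{-φ(s)}`, which is odd in `φ(s)`. Replacing `φ` by `φ'` therefore multiplies `ξ_s` by
`ε(s)` (`xi_eq_signOf_mul`), and `ε(s) T_s^{φ'}` satisfies the quadratic relation of `T_s^φ`.

No presentation of the algebra is invoked. `theta_T_simple_mul` compares left multiplication by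
`T_s` on the two standard bases, and induction on the length of the left factor gives
multiplicativity (`theta_mul`). The same induction, with `T_s⁻¹ = T_s - ξ_s` in place of `T_s`,
gives compatibility with the bar involution (`theta_bar`).

On standard coordinates `θ` is multiplication by signs, so it preserves the negative part. Hence
`ε(w) θ(C_w^φ)` has both properties that characterise `C_w^{φ'}`, and uniqueness identifies the two
(`theta_C`). So `θ` multiplies Kazhdan–Lusztig coordinates by signs as well, and it carries `h
C_y^φ` to `±θ(h) C_y^{φ'}`. Non-vanishing of coefficients is unaffected, so arrows for `φ` are
arrows for `φ'`. The hypotheses are symmetric in `φ` and `φ'`, which gives the converse. -/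

namespace KazhdanLusztig

/-! ### The sign character attached to a union of classes of simple reflections. -/

section SignCharacter

variable {B W : Type*} [Group W] {M : CoxeterMatrix B} (cs : CoxeterSystem M W)
variable {Γ : Type*} [AddCommGroup Γ]

variable (Γ) in
open Classical in
/-- The sign `-1` for indices in `P` and `1` otherwise. -/
noncomputable def signOf (P : Set B) (i : B) : GroupRing Γ := if i ∈ P then -1 else 1

variable (Γ) in
/-- The sign `(-1)^{ℓ_P(w)}`. -/
noncomputable def signLength (P : Set B) (w : W) : GroupRing Γ := (-1) ^ lengthIn cs P w

/-- `P` is a union of conjugacy classes of simple reflections, and `φ'` is obtained from `φ` by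
changing the sign on `P`. -/
structure IsSignChange (P : Set B) (φ φ' : SimpleClass cs → Γ) : Prop where
  conj : ∀ i j, IsConj (cs.simple i) (cs.simple j) → (i ∈ P ↔ j ∈ P)
  of_mem : ∀ i ∈ P, φ' (simpleClass cs i) = -φ (simpleClass cs i)
  of_notMem : ∀ i ∉ P, φ' (simpleClass cs i) = φ (simpleClass cs i)

variable {cs} in
-- This symmetry lets the comparison of arrows be proved in one direction only.
theorem IsSignChange.symm {P : Set B} {φ φ' : SimpleClass cs → Γ} (H : IsSignChange cs P φ φ') :
    IsSignChange cs P φ' φ where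
  conj := H.conj
  of_mem i hi := by rw [H.of_mem i hi, neg_neg]
  of_notMem i hi := (H.of_notMem i hi).symm

theorem signOf_mul_self (P : Set B) (i : B) : signOf Γ P i * signOf Γ P i = 1 := by
  unfold signOf; split_ifs <;> simp

theorem barG_signOf (P : Set B) (i : B) : barG (signOf Γ P i) = signOf Γ P i := by
  unfold signOf; split_ifs <;> simp

theorem signLength_mul_self (P : Set B) (w : W) :
    signLength cs Γ P w * signLength cs Γ P w = 1 := by
  rw [signLength, ← mul_pow]; simp

theorem barG_signLength (P : Set B) (w : W) :
    barG (signLength cs Γ P w) = signLength cs Γ P w := by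
  simp [signLength]

theorem signLength_one (P : Set B) : signLength cs Γ P 1 = 1 := by
  -- `lengthIn` is computed on a chosen reduced word; for the identity, having length `0` forces
  -- that word to be empty.
  have h : reducedWord cs (1 : W) = [] := by
    rw [← List.length_eq_zero_iff, ← (isReduced_reducedWord cs 1).eq, wordProd_reducedWord,
      cs.length_one]
  simp [signLength, lengthIn, h]

variable {cs} {P : Set B} {φ φ' : SimpleClass cs → Γ}

/-- A sign is its own inverse, so the absence of zero divisors in `ℤ[Γ]` plays no role. -/
theorem signLength_mul_ne_zero {a : GroupRing Γ} (ha : a ≠ 0) (w : W) :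
    signLength cs Γ P w * a ≠ 0 := by
  intro h
  apply ha
  rw [← one_mul a, ← signLength_mul_self cs P w, mul_assoc, h, mul_zero]

/-- Prefixing `i` to a reduced word of `w` gives a reduced word of `s_i w`. Invariance of `P` under
conjugacy allows both signs to be read off these words instead of the chosen ones. -/
theorem signLength_simple_mul_of_lt (H : IsSignChange cs P φ φ') {i : B} {w : W}
    (h : cs.length w < cs.length (cs.simple i * w)) :
    signLength cs Γ P (cs.simple i * w) = signOf Γ P i * signLength cs Γ P w := by
  classical
  obtain ⟨ω, hω, rfl⟩ := cs.exists_isReduced w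
  have h1 := cs.length_simple_mul (cs.wordProd ω) i
  have hr : cs.IsReduced (i :: ω) := by
    rw [CoxeterSystem.IsReduced, cs.wordProd_cons, List.length_cons, ← hω.eq]; omega
  rw [← cs.wordProd_cons, signLength, signLength, lengthIn_wordProd cs H.conj hr,
    lengthIn_wordProd cs H.conj hω, List.countP_cons, signOf]
  split_ifs <;> simp_all [pow_succ]

/-- Signs square to `1`, so the length-decreasing case is the length-increasing one applied to `s_i
w`. This makes the sign a character of `W`. -/
theorem signLength_simple_mul (H : IsSignChange cs P φ φ') (i : B) (w : W) :
    signLength cs Γ P (cs.simple i * w) = signOf Γ P i * signLength cs Γ P w := by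
  rcases cs.length_simple_mul w i with hl | hl
  · exact signLength_simple_mul_of_lt H (by omega)
  · have := signLength_simple_mul_of_lt H (i := i) (w := cs.simple i * w) (by simp; omega)
    rw [cs.simple_mul_simple_cancel_left] at this
    rw [this, ← mul_assoc, signOf_mul_self, one_mul]

/-- `ξ_i` is an odd function of the parameter. This is the only way in which the change of
parameters affects the multiplication. -/
theorem xi_eq_signOf_mul (H : IsSignChange cs P φ φ') (i : B) :
    xi cs φ' i = signOf Γ P i * xi cs φ i := by
  rw [signOf]
  split_ifs with hi
  · rw [xi, xi, H.of_mem i hi, neg_neg]; ring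
  · rw [xi, xi, H.of_notMem i hi, one_mul]

/-! ### The map `θ` -/

theorem theta_T (w : W) :
    theta cs P φ φ' (T cs φ w) = signLength cs Γ P w • T cs φ' w := by
  rw [theta, T, Module.Basis.constr_basis]; rfl

theorem theta_one : theta cs P φ φ' 1 = 1 := by
  rw [← T_one, theta_T, signLength_one, one_smul, T_one]

/-- The sign of `w` does not involve the parameters, so going forth and back multiplies `T_w` by a
square of a sign. The inverse of `θ` is thus `θ` with `φ` and `φ'` exchanged. -/
theorem theta_theta (h : Hecke cs φ) : theta cs P φ' φ (theta cs P φ φ' h) = h := by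
  have : theta cs P φ' φ ∘ₗ theta cs P φ φ' = LinearMap.id := by
    refine (stdBasis cs φ).ext fun w => ?_
    change theta cs P φ' φ (theta cs P φ φ' (T cs φ w)) = T cs φ w
    rw [theta_T, map_smul, theta_T, smul_smul, signLength_mul_self, one_smul]
  exact LinearMap.congr_fun this h

/-- The heart of the proof that `θ` is multiplicative. If `s` lengthens `w`, only the character
property of the sign matters. Otherwise the extra term `ξ_s T_w` must also match, and it does
because the sign of `s` appears twice: once from the sign of `sw`, once from the change of `ξ_s`. -/
theorem theta_T_simple_mul (H : IsSignChange cs P φ φ') (i : B) (h : Hecke cs φ) :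
    theta cs P φ φ' (T cs φ (cs.simple i) * h) =
      signOf Γ P i • (T cs φ' (cs.simple i) * theta cs P φ φ' h) := by
  induction h using hecke_induction with
  | zero => simp
  | add x y hx hy => rw [mul_add, map_add, map_add, mul_add, smul_add, hx, hy]
  | smul a w =>
    rw [mul_smul_comm, map_smul, map_smul, mul_smul_comm, smul_comm _ a]
    congr 1
    rw [theta_T, mul_smul_comm, smul_smul, ← signLength_simple_mul H]
    rcases cs.length_simple_mul w i with hl | hl
    · rw [T_simple_mul_of_lt cs φ (by omega), T_simple_mul_of_lt cs φ' (by omega), theta_T]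
    · rw [T_simple_mul_of_gt cs φ (by omega), T_simple_mul_of_gt cs φ' (by omega), map_add,
        map_smul, theta_T, theta_T, smul_add, smul_smul, smul_smul, xi_eq_signOf_mul H,
        signLength_simple_mul H]
      congr 2
      -- The two coefficients of `T_w` differ by the factor `ε(s)²`, which is `1`.
      linear_combination
        (-(xi cs φ i * signLength cs Γ P w)) * signOf_mul_self (Γ := Γ) P i

/-- Induction on length through left descents: every element is reached from `1` by
length-increasing left multiplications by simple reflections, along which `T_s T_w = T_{sw}`. -/
theorem simple_mul_induction {p : W → Prop} (one : p 1)
    (simple_mul : ∀ i w, cs.length w < cs.length (cs.simple i * w) → p w → p (cs.simple i * w))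
    (w : W) : p w := by
  induction hn : cs.length w generalizing w with
  | zero =>
    rw [cs.length_eq_zero_iff] at hn
    rwa [hn]
  | succ n ih =>
    obtain ⟨i, hi⟩ := cs.exists_leftDescent_of_ne_one (w := w) (by rintro rfl; simp at hn)
    have hi' : cs.length (cs.simple i * w) < cs.length w := hi
    have h1 := cs.length_simple_mul w i
    have := simple_mul i (cs.simple i * w) (by simpa using hi') (ih _ (by omega))
    rwa [cs.simple_mul_simple_cancel_left] at this

theorem theta_T_simple (H : IsSignChange cs P φ φ') (i : B) :
    theta cs P φ φ' (T cs φ (cs.simple i)) = signOf Γ P i • T cs φ' (cs.simple i) := by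
  simpa [theta_one] using theta_T_simple_mul H i 1

/-- By linearity the left factor may be taken to be `T_w`. Letters of `w` are then peeled off on the
left with `theta_T_simple_mul`, which accepts an arbitrary right factor, so the second argument is
never decomposed. -/
theorem theta_mul (H : IsSignChange cs P φ φ') (h h' : Hecke cs φ) :
    theta cs P φ φ' (h * h') = theta cs P φ φ' h * theta cs P φ φ' h' := by
  induction h using hecke_induction with
  | zero => simp
  | add x y hx hy => rw [add_mul, map_add, map_add, add_mul, hx, hy]
  | smul a w =>
    rw [smul_mul_assoc, map_smul, map_smul, smul_mul_assoc]
    congr 1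
    induction w using simple_mul_induction (cs := cs) with
    | one => rw [T_one, theta_one, one_mul, one_mul]
    | simple_mul i w hw ih =>
      rw [← T_simple_mul_of_lt cs φ hw, mul_assoc, theta_T_simple_mul H, ih,
        theta_T_simple_mul H, smul_mul_assoc, mul_assoc]

/-- `θ` as an isomorphism of algebras. -/
noncomputable def thetaEquiv (H : IsSignChange cs P φ φ') :
    Hecke cs φ ≃ₐ[GroupRing Γ] Hecke cs φ' :=
  AlgEquiv.ofBijective (AlgHom.ofLinearMap (theta cs P φ φ') theta_one (theta_mul H))
    ⟨Function.LeftInverse.injective (g := theta cs P φ' φ) fun h => theta_theta h,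
      Function.RightInverse.surjective (g := theta cs P φ' φ) fun h => theta_theta h⟩

/-! ### Compatibility with the bar involution. -/

theorem theta_TsInv (H : IsSignChange cs P φ φ') (i : B) :
    theta cs P φ φ' (TsInv cs φ i) = signOf Γ P i • TsInv cs φ' i := by
  rw [TsInv, TsInv, map_sub, map_smul, theta_one, theta_T_simple H, smul_sub, smul_smul,
    xi_eq_signOf_mul H, ← mul_assoc, signOf_mul_self, one_mul]

/-- Both sides are semilinear, so it suffices to treat `T_w`. Bar turns a left factor `T_s` into
`T_s⁻¹`, and `θ` multiplies each of `T_s` and `T_s⁻¹` by the same sign, which is itself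
bar-invariant. -/
theorem theta_bar (H : IsSignChange cs P φ φ') (h : Hecke cs φ) :
    theta cs P φ φ' (bar cs φ h) = bar cs φ' (theta cs P φ φ' h) := by
  induction h using hecke_induction with
  | zero => simp [bar_zero]
  | add x y hx hy => rw [bar_add, map_add, map_add, bar_add, hx, hy]
  | smul a w =>
    rw [bar_smul, map_smul, map_smul, bar_smul]
    congr 1
    induction w using simple_mul_induction (cs := cs) with
    | one => rw [bar_T, barT_one, theta_one, T_one, theta_one, ← T_one, bar_T, barT_one]; rfl
    | simple_mul i w hw ih =>
      rw [← T_simple_mul_of_lt cs φ hw, bar_T_simple_mul, theta_mul H, theta_TsInv H, ih,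
        theta_T_simple_mul H, bar_smul, barG_signOf, bar_T_simple_mul, smul_mul_assoc]

/-! ### Standard coordinates and the negative part. -/

theorem stdBasis_repr_theta (h : Hecke cs φ) (w : W) :
    (stdBasis cs φ').repr (theta cs P φ φ' h) w =
      signLength cs Γ P w * (stdBasis cs φ).repr h w := by
  classical
  induction h using hecke_induction with
  | zero => simp
  | add x y hx hy => simp only [map_add, Finsupp.add_apply, hx, hy, mul_add]
  | smul a v =>
    rw [map_smul, theta_T, T, T]
    simp only [map_smul, Module.Basis.repr_self, Finsupp.smul_apply, Finsupp.single_apply,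
      smul_eq_mul]
    split_ifs with e
    · rw [e]; ring
    · simp

variable [LinearOrder Γ]

variable (cs P) in
theorem signLength_mul_mem_negG {a : GroupRing Γ} (ha : a ∈ negG Γ) (w : W) :
    signLength cs Γ P w * a ∈ negG Γ := by
  -- `negG Γ` is only an additive subgroup, so the sign is split into its two values and closure
  -- under negation is used.
  rcases neg_one_pow_eq_or (GroupRing Γ) (lengthIn cs P w) with e | e
  · rwa [signLength, e, one_mul]
  · rw [signLength, e, neg_one_mul]; exact neg_mem ha

theorem signLength_smul_mem_heckeNeg {h : Hecke cs φ} (hh : h ∈ heckeNeg cs φ) (w : W) :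
    signLength cs Γ P w • h ∈ heckeNeg cs φ := fun v => by
  rw [map_smul, Finsupp.smul_apply, smul_eq_mul]
  exact signLength_mul_mem_negG cs P (hh v) w

theorem theta_mem_heckeNeg {h : Hecke cs φ} (hh : h ∈ heckeNeg cs φ) :
    theta cs P φ φ' h ∈ heckeNeg cs φ' := fun w => by
  rw [stdBasis_repr_theta]
  exact signLength_mul_mem_negG cs P (hh w) w

theorem theta_image_heckeNeg :
    theta cs P φ φ' '' (heckeNeg cs φ : Set _) = (heckeNeg cs φ' : Set _) := by
  ext h
  constructor
  · rintro ⟨g, hg, rfl⟩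
    exact theta_mem_heckeNeg hg
  · intro hh
    exact ⟨theta cs P φ' φ h, theta_mem_heckeNeg hh, theta_theta h⟩

/-! ### Kazhdan–Lusztig elements, preorders and cells. -/

variable [IsOrderedAddMonoid Γ]

/-- Uniqueness of Kazhdan–Lusztig elements for `φ'`, applied to the image of `C_w` corrected by the
sign of `w`. The correction makes its leading term exactly `T_w`, and does not disturb
bar-invariance because signs are fixed by bar. -/
theorem theta_C (H : IsSignChange cs P φ φ') (w : W) :
    theta cs P φ φ' (C cs φ w) = signLength cs Γ P w • C cs φ' w := by
  have hC := isKLElement_C cs φ w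
  have key : IsKLElement cs φ' w (signLength cs Γ P w • theta cs P φ φ' (C cs φ w)) := by
    constructor
    · rw [bar_smul, barG_signLength, ← theta_bar H, hC.1]
    · have := signLength_smul_mem_heckeNeg (P := P)
        (theta_mem_heckeNeg (P := P) (φ' := φ') hC.2) w
      rwa [map_sub, smul_sub, theta_T, smul_smul, signLength_mul_self, one_smul] at this
  rw [← isKLElement_unique cs φ' key (isKLElement_C cs φ' w), smul_smul, signLength_mul_self,
    one_smul]

/-- By `theta_C`, `θ` is diagonal with sign entries from one Kazhdan–Lusztig basis to the other; two
linear forms are compared on that basis. -/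
theorem klBasis_repr_theta (H : IsSignChange cs P φ φ') (h : Hecke cs φ) (x : W) :
    (klBasis cs φ').repr (theta cs P φ φ' h) x =
      signLength cs Γ P x * (klBasis cs φ).repr h x := by
  classical
  have : (klBasis cs φ').coord x ∘ₗ theta cs P φ φ' =
      signLength cs Γ P x • (klBasis cs φ).coord x := by
    refine (klBasis cs φ).ext fun w => ?_
    rw [LinearMap.comp_apply, klBasis_apply, theta_C H, map_smul, LinearMap.smul_apply,
      ← klBasis_apply, ← klBasis_apply]
    simp only [Module.Basis.coord_apply, Module.Basis.repr_self, Finsupp.single_apply, smul_eq_mul]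
    split_ifs with e
    · rw [e]
    · simp
  exact LinearMap.congr_fun this h

/-- Since `θ(h C_y)` is `θ(h) C_y` up to the sign of `y`, the coefficients of `C_x` for the two
parameters differ by the signs of `x` and `y` only. So `θ(h)` witnesses an arrow for `φ'` whenever
`h` does for `φ`. -/
theorem klBasis_repr_theta_mul_C_ne_zero (H : IsSignChange cs P φ φ') {h : Hecke cs φ} {x y : W}
    (hh : (klBasis cs φ).repr (h * C cs φ y) x ≠ 0) :
    (klBasis cs φ').repr (theta cs P φ φ' h * C cs φ' y) x ≠ 0 := by
  intro h0
  have h1 := klBasis_repr_theta H (h * C cs φ y) x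
  rw [theta_mul H, theta_C H, mul_smul_comm, map_smul, Finsupp.smul_apply, h0, smul_zero] at h1
  exact signLength_mul_ne_zero hh x h1.symm

theorem klBasis_repr_C_mul_theta_ne_zero (H : IsSignChange cs P φ φ') {h : Hecke cs φ} {x y : W}
    (hh : (klBasis cs φ).repr (C cs φ y * h) x ≠ 0) :
    (klBasis cs φ').repr (C cs φ' y * theta cs P φ φ' h) x ≠ 0 := by
  intro h0
  have h1 := klBasis_repr_theta H (C cs φ y * h) x
  rw [theta_mul H, theta_C H, smul_mul_assoc, map_smul, Finsupp.smul_apply, h0, smul_zero] at h1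
  exact signLength_mul_ne_zero hh x h1.symm

theorem Arrow.of_isSignChange (H : IsSignChange cs P φ φ') {d : Side} {x y : W}
    (h : Arrow cs φ d x y) : Arrow cs φ' d x y := by
  cases d with
  | L => exact h.imp' _ fun g hg => klBasis_repr_theta_mul_C_ne_zero H hg
  | R => exact h.imp' _ fun g hg => klBasis_repr_C_mul_theta_ne_zero H hg
  | LR =>
    exact h.imp' _ fun g hg => hg.imp (klBasis_repr_theta_mul_C_ne_zero H)
      (klBasis_repr_C_mul_theta_ne_zero H)

theorem cellLE_iff_of_isSignChange (H : IsSignChange cs P φ φ') (d : Side) (x y : W) :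
    CellLE cs φ d x y ↔ CellLE cs φ' d x y :=
  -- An inclusion of arrows passes to transitive closures; the reverse inclusion comes from
  -- exchanging `φ` and `φ'`.
  ⟨Relation.TransGen.mono (fun _ _ h => Arrow.of_isSignChange H h) x y,
    Relation.TransGen.mono (fun _ _ h => Arrow.of_isSignChange H.symm h) x y⟩

end SignCharacter

end KazhdanLusztig

theorem mainTheorem5 {B W Γ : Type*} [Group W] {M : CoxeterMatrix B} (cs : CoxeterSystem M W)
    [AddCommGroup Γ] [LinearOrder Γ] [IsOrderedAddMonoid Γ]
    (Splus Sminus : Set B) (hpart : IsCompl Splus Sminus)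
    (hconj : ∀ i ∈ Splus, ∀ j ∈ Sminus, ¬ IsConj (cs.simple i) (cs.simple j))
    (φ φ' : KazhdanLusztig.SimpleClass cs → Γ)
    (hplus : ∀ i ∈ Splus,
      φ' (KazhdanLusztig.simpleClass cs i) = φ (KazhdanLusztig.simpleClass cs i))
    (hminus : ∀ i ∈ Sminus,
      φ' (KazhdanLusztig.simpleClass cs i) = -φ (KazhdanLusztig.simpleClass cs i)) :
    (∃ e : KazhdanLusztig.Hecke cs φ ≃ₐ[KazhdanLusztig.GroupRing Γ] KazhdanLusztig.Hecke cs φ',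
      ∀ h, e h = KazhdanLusztig.theta cs Sminus φ φ' h) ∧
    KazhdanLusztig.theta cs Sminus φ φ' '' (KazhdanLusztig.heckeNeg cs φ : Set _) =
      (KazhdanLusztig.heckeNeg cs φ' : Set _) ∧
    (∀ h : KazhdanLusztig.Hecke cs φ,
      KazhdanLusztig.theta cs Sminus φ φ' (KazhdanLusztig.bar cs φ h) =
        KazhdanLusztig.bar cs φ' (KazhdanLusztig.theta cs Sminus φ φ' h)) ∧
    (∀ w : W, KazhdanLusztig.theta cs Sminus φ φ' (KazhdanLusztig.C cs φ w) =
      (-1 : KazhdanLusztig.GroupRing Γ) ^ KazhdanLusztig.lengthIn cs Sminus w •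
        KazhdanLusztig.C cs φ' w) ∧
    (∀ (d : KazhdanLusztig.Side) (x y : W),
      (KazhdanLusztig.CellLE cs φ d x y ↔ KazhdanLusztig.CellLE cs φ' d x y) ∧
      (KazhdanLusztig.CellEquiv cs φ d x y ↔ KazhdanLusztig.CellEquiv cs φ' d x y)) := by
  have hmem : ∀ i, i ∉ Sminus → i ∈ Splus := fun i hi =>
    (hpart.codisjoint.top_le (Set.mem_univ i)).resolve_right hi
  have H : KazhdanLusztig.IsSignChange cs Sminus φ φ' :=
    -- If exactly one of two conjugate reflections lay in `Sminus`, the other would lie in `Splus`,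
    -- contradicting `hconj`.
    { conj := fun i j h => by
        constructor
        · exact fun hi => by_contra fun hj => hconj j (hmem j hj) i hi h.symm
        · exact fun hj => by_contra fun hi => hconj i (hmem i hi) j hj h
      of_mem := hminus
      of_notMem := fun i hi => hplus i (hmem i hi) }
  refine ⟨⟨KazhdanLusztig.thetaEquiv H, fun _ => rfl⟩, KazhdanLusztig.theta_image_heckeNeg,
    KazhdanLusztig.theta_bar H, KazhdanLusztig.theta_C H, fun d x y => ?_⟩
  have hLE := KazhdanLusztig.cellLE_iff_of_isSignChange H d
  exact ⟨hLE x y, and_congr (hLE x y) (hLE y x)⟩
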